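/- Conventions. For $k\in\mathbb N$ we identify $k$ with $\{0,\dots,k-1\}$. A represented space is a set $X$ with a surjective partial map $\delta_X:\subseteq\mathbb N^{\mathbb N}\to X$; if $\delta_X(p)=x$, then $p$ is called a name of $x$. A problem $f:\subseteq X\rightrightarrows Y$ is a partial multi-valued function between represented spaces, with $\mathrm{dom}(f)=\{x: f(x)\neq\emptyset\}$; it is computable if some (type-two) computable partial function on $\mathbb N^{\mathbb N}$ maps every name of every $x\in\mathrm{dom}(f)$ to a name of some element of $f(x)$. Composition is $(g\circ f)(x)=\{z:(\exists y\in f(x))\; z\in g(y)\}$ with domain $\{x\in\mathrm{dom}(f): f(x)\subseteq\mathrm{dom}(g)\}$, and $f\times g$ is the product, $(f\times g)(x,w)=f(x)\times g(w)$. For $f:\subseteq X\rightrightarrows Y$ and $g:\subseteq W\rightrightarrows Z$ we write $f\leq_{\mathrm W}g$ if there are computable problems $K:\subseteq X\rightrightarrows W$ and $H:\subseteq X\times Z\rightrightarrows Y$ such that $\emptyset\neq H(x,gK(x))\subseteq f(x)$ for all $x\in\mathrm{dom}(f)$. Let $\lim:\subseteq\mathbb N^{\mathbb N}\to\mathbb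 N^{\mathbb N}$, $\langle p_0,p_1,p_2,\dots\rangle\mapsto\lim_{i\to\infty}p_i$, be the limit map on Baire space (defined on the codes of convergent sequences). The jump $f'$ of a problem $f:\subseteq X\rightrightarrows Y$ is the same problem with the input representation $\delta_X$ replaced by $\delta_X\circ\lim$. The problem $\mathsf{BWT}_k:k^{\mathbb N}\rightrightarrows k$ is: given a sequence in the discrete space $k$, find a cluster point of it, i.e. a value that occurs infinitely often. A coloring is a map $c:[\mathbb N]^n\to k$ on the $n$-element subsets of $\mathbb N$; its names are the $p$ with $p(i)=c(\vartheta_n(i))$ for all $i$, where $\vartheta_n$ is a standard numbering of $[\mathbb N]^n$. The problem $\mathsf{RT}_{n,k}$ is: given a coloring $c:[\mathbb N]^n\to k$, find (the characteristic function of) an infinite set $M\subseteq\mathbb N$ that is homogeneous for $c$, i.e. such that $c$ is constant on $[M]^n$. The problem $\mathsf{SRT}_{n,k}$ is the restriction of $\mathsf{RT}_{n,k}$ to the stable colorings, i.e. to those $c$ for which $\lim_{i\to\infty}c(A\cup\{i\})$ exists for every $A\in[\mathbb N]^{n-1}$. Theorem. For every $k\geq1$: (1) $\mathsf{BWT}_{k+1}\not\leq_{\mathrm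 W}\mathsf{RT}_{1,k}'\times\lim$; (2) $\mathsf{BWT}_{k+1}\not\leq_{\mathrm W}\mathsf{SRT}_{2,k}$; (3) $\mathsf{SRT}_{2,k+1}\not\leq_{\mathrm W}\mathsf{SRT}_{2,k}$. -/

import Mathlib

/-! Represented spaces, problems, type-two computability and Weihrauch reducibility, and the
problems `lim`, `BWT_k`, `RT_{n,k}` and `SRT_{n,k}`. -/

namespace Weihrauch

open Filter Topology

/-- Baire space, with the product topology of the discrete topology on `ℕ`. -/
abbrev Baire : Type := ℕ → ℕ

/-- The prefix of length `n` of a point of Baire space. -/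
def pre (p : Baire) (n : ℕ) : List ℕ := (List.range n).map p

/-- Type-two computability: the partial function `F` on Baire space is computable if some
computable word function `h`, monotone for the prefix order, satisfies `F p = sup_m h (pre p m)`
for every `p` in the domain of `F`. -/
def TypeTwoComputable (F : Baire →. Baire) : Prop :=
  ∃ h : List ℕ → List ℕ, Computable h ∧ (∀ u v : List ℕ, u <+: v → h u <+: h v) ∧
    ∀ p q : Baire, q ∈ F p →
      (∀ m, h (pre p m) = pre q (h (pre p m)).length) ∧
      ∀ n, ∃ m, n ≤ (h (pre p m)).length

/-- A represented space: a set together with a surjective partial map from Baire space onto it.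
The partial map is given by its graph, `names p x` meaning that `p` is a name of `x`. -/
structure RepSpace where
  carrier : Type
  names : Baire → carrier → Prop
  names_unique : ∀ p x y, names p x → names p y → x = y
  exists_name : ∀ x, ∃ p, names p x

/-- A problem, i.e. a partial multi-valued function between represented spaces: `f.sol x` is the
set of solutions of the instance `x`, and it is empty exactly if `x` is not in the domain. -/
structure Problem (X Y : RepSpace) where
  sol : X.carrier → Set Y.carrier

namespace Problem

variable {X Y Z W : RepSpace}

/-- The domain of a problem. -/
def dom (f : Problem X Y) : Set X.carrier := {x | (f.sol x).Nonempty}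

/-- The composition `g ∘ f`, with domain `{x ∈ dom f | f x ⊆ dom g}`. -/
def comp (g : Problem Y Z) (f : Problem X Y) : Problem X Z where
  sol x := {z | f.sol x ⊆ g.dom ∧ ∃ y ∈ f.sol x, z ∈ g.sol y}

/-- The partial function `F` on Baire space realizes `f`: it maps every name of every `x ∈ dom f`
to a name of some element of `f x`. -/
def RealizedBy (f : Problem X Y) (F : Baire →. Baire) : Prop :=
  ∀ p x, X.names p x → x ∈ f.dom → ∃ q ∈ F p, ∃ y ∈ f.sol x, Y.names q y

/-- A problem is computable if it has a computable realizer. -/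
def IsComputable (f : Problem X Y) : Prop :=
  ∃ F : Baire →. Baire, TypeTwoComputable F ∧ f.RealizedBy F

end Problem

/-- The product of two represented spaces, for the pairing `⟨p, q⟩ (2 n) = p n`,
`⟨p, q⟩ (2 n + 1) = q n` of Baire space. -/
def RepSpace.prod (X Y : RepSpace) : RepSpace where
  carrier := X.carrier × Y.carrier
  names r xy := X.names (fun n => r (2 * n)) xy.1 ∧ Y.names (fun n => r (2 * n + 1)) xy.2
  names_unique := fun _ _ _ h h' =>
    Prod.ext (X.names_unique _ _ _ h.1 h'.1) (Y.names_unique _ _ _ h.2 h'.2)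
  exists_name := by
    rintro ⟨x, y⟩
    obtain ⟨p, hp⟩ := X.exists_name x
    obtain ⟨q, hq⟩ := Y.exists_name y
    refine ⟨fun n => if n % 2 = 0 then p (n / 2) else q (n / 2), ?_, ?_⟩
    · have h : (fun n => if (2 * n) % 2 = 0 then p (2 * n / 2) else q (2 * n / 2)) = p := by
        funext n; simp
      simpa only [h] using hp
    · have h : (fun n => if (2 * n + 1) % 2 = 0 then p ((2 * n + 1) / 2)
          else q ((2 * n + 1) / 2)) = q := by
        funext n
        have h1 : (2 * n + 1) % 2 ≠ 0 := by omega
        have h2 : (2 * n + 1) / 2 = n := by omega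
        rw [if_neg h1, h2]
      simpa only [h] using hq

namespace Problem

variable {X Y Z W : RepSpace}

/-- The product of two problems: solve an instance of each of them. -/
def prod (f : Problem X Y) (g : Problem W Z) : Problem (X.prod W) (Y.prod Z) where
  sol x := f.sol x.1 ×ˢ g.sol x.2

/-- The multi-valued function `x ↦ {x} × f x`. -/
def withInput (f : Problem X Y) : Problem X (X.prod Y) where
  sol x := {x} ×ˢ f.sol x

/-- Weihrauch reducibility `f ≤_W g`: there are computable multi-valued partial functions
`K` from `X` to `W` and `H` from `X × Z` to `Y` such that `∅ ≠ H (x, g K (x)) ⊆ f x` for all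
`x ∈ dom f`. -/
def WeihrauchReducible (f : Problem X Y) (g : Problem W Z) : Prop :=
  ∃ (K : Problem X W) (H : Problem (X.prod Z) Y), K.IsComputable ∧ H.IsComputable ∧
    ∀ x ∈ f.dom,
      ((H.comp (g.comp K).withInput).sol x).Nonempty ∧
      (H.comp (g.comp K).withInput).sol x ⊆ f.sol x

end Problem

/-- `q` is the limit in Baire space of the sequence coded by `p = ⟨p_0, p_1, p_2, …⟩`,
where `p_i n = p ⟨i, n⟩`. -/
def IsLim (p q : Baire) : Prop :=
  Tendsto (fun i : ℕ => (fun n => p (Nat.pair i n) : Baire)) atTop (𝓝 q)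

/-- The jump of a represented space: the representation `δ` is replaced by `δ ∘ lim`. -/
def RepSpace.jump (X : RepSpace) : RepSpace where
  carrier := X.carrier
  names p x := ∃ q, IsLim p q ∧ X.names q x
  names_unique := by
    rintro p x y ⟨q, hq, hx⟩ ⟨q', hq', hy⟩
    obtain rfl : q = q' := tendsto_nhds_unique hq hq'
    exact X.names_unique _ _ _ hx hy
  exists_name := by
    intro x
    obtain ⟨q, hq⟩ := X.exists_name x
    refine ⟨fun m => q m.unpair.2, q, ?_, hq⟩
    simp only [IsLim, Nat.unpair_pair]
    exact tendsto_const_nhds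

/-- The jump of a problem: the same problem, with the jump of the input representation. -/
def Problem.jump {X Y : RepSpace} (f : Problem X Y) : Problem X.jump Y where
  sol := f.sol

/-- Baire space, represented by the identity. -/
def baireSpace : RepSpace where
  carrier := Baire
  names p x := p = x
  names_unique := fun _ _ _ h h' => h.symm.trans h'
  exists_name := fun x => ⟨x, rfl⟩

/-- The finite discrete space `k = {0, …, k - 1}`; a name of `j` is any `p` with `p 0 = j`. -/
def finSpace (k : ℕ) : RepSpace where
  carrier := Fin k
  names p j := p 0 = j
  names_unique := fun _ _ _ h h' => Fin.ext (h.symm.trans h')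
  exists_name := fun j => ⟨fun _ => j, rfl⟩

/-- The space `k^ℕ` of sequences in `k = {0, …, k - 1}`, as a subspace of Baire space. -/
def seqSpace (k : ℕ) : RepSpace where
  carrier := ℕ → Fin k
  names p x := ∀ n, p n = x n
  names_unique := fun _ _ _ h h' => funext fun n => Fin.ext ((h n).symm.trans (h' n))
  exists_name := fun x => ⟨fun n => x n, fun _ => rfl⟩

/-- Cantor space `2^ℕ` as the space of subsets of `ℕ`, named by their characteristic functions. -/
def setSpace : RepSpace where
  carrier := Set ℕ
  names p M := p = M.indicator 1
  names_unique := fun _ _ _ h h' => Set.indicator_one_inj ℕ (h.symm.trans h')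
  exists_name := fun M => ⟨M.indicator 1, rfl⟩

/-- The limit map on Baire space, defined on the codes of convergent sequences. -/
def lim : Problem baireSpace baireSpace where
  sol p := {q | IsLim p q}

/-- The Bolzano-Weierstrass theorem for the discrete space `k = {0, …, k - 1}`: find a cluster
point of a given sequence. -/
def BWT (k : ℕ) : Problem (seqSpace k) (finSpace k) where
  sol x := {j : Fin k | MapClusterPt j atTop (x : ℕ → Fin k)}

/-- The standard numbering of the `n`-element subsets of `ℕ`:
`⟨i_0, …, i_{n-1}⟩` is a number of `{i_0 < i_0 + i_1 + 1 < i_0 + i_1 + i_2 + 2 < …}`. -/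
def theta : ℕ → ℕ → Finset ℕ
  | 0, _ => ∅
  | 1, i => {i}
  | n + 2, i => insert i.unpair.1
      ((theta (n + 1) i.unpair.2).map (addRightEmbedding (i.unpair.1 + 1)))

theorem card_theta : ∀ n i : ℕ, (theta n i).card = n
  | 0, _ => rfl
  | 1, _ => rfl
  | n + 2, i => by
    rw [theta, Finset.card_insert_of_notMem, Finset.card_map, card_theta (n + 1)]
    simp only [Finset.mem_map, addRightEmbedding_apply, not_exists, not_and]
    intro a _ h
    omega

theorem exists_theta : ∀ (n : ℕ) (A : Finset ℕ), A.card = n → ∃ i, theta n i = A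
  | 0, A, h => ⟨0, (Finset.card_eq_zero.1 h).symm⟩
  | 1, A, h => by
    obtain ⟨a, rfl⟩ := Finset.card_eq_one.1 h
    exact ⟨a, rfl⟩
  | n + 2, A, h => by
    have hne : A.Nonempty := by
      rw [← Finset.card_pos]; omega
    set a := A.min' hne with ha
    have hmem : a ∈ A := A.min'_mem hne
    have hlt : ∀ b ∈ A.erase a, a + 1 ≤ b := by
      intro b hb
      have h1 : a ≤ b := A.min'_le b (Finset.mem_of_mem_erase hb)
      have h2 : b ≠ a := Finset.ne_of_mem_erase hb
      omega
    obtain ⟨r, hr⟩ := exists_theta (n + 1) ((A.erase a).image fun b => b - (a + 1)) (by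
      rw [Finset.card_image_of_injOn, Finset.card_erase_of_mem hmem, h]
      · rfl
      · intro b hb b' hb' hbb
        have h1 := hlt b hb
        have h2 := hlt b' hb'
        have h3 : b - (a + 1) = b' - (a + 1) := hbb
        omega)
    refine ⟨Nat.pair a r, ?_⟩
    rw [theta, Nat.unpair_pair, hr]
    ext b
    simp only [Finset.mem_insert, Finset.mem_map, Finset.mem_image, addRightEmbedding_apply]
    constructor
    · rintro (rfl | ⟨_, ⟨c, hc, rfl⟩, rfl⟩)
      · exact hmem
      · rw [Nat.sub_add_cancel (hlt c hc)]
        exact Finset.mem_of_mem_erase hc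
    · intro hb
      by_cases hba : b = a
      · exact Or.inl hba
      · have hb' : b ∈ A.erase a := Finset.mem_erase.2 ⟨hba, hb⟩
        exact Or.inr ⟨_, ⟨b, hb', rfl⟩, Nat.sub_add_cancel (hlt b hb')⟩

/-- Colorings of the `n`-element subsets of `ℕ` with `k` colors. -/
abbrev Coloring (n k : ℕ) : Type := {A : Finset ℕ // A.card = n} → Fin k

/-- The space of colorings; `p` is a name of `c` if `p i = c (theta n i)` for all `i`. -/
def coloringSpace (n k : ℕ) : RepSpace where
  carrier := Coloring n k
  names p c := ∀ i, p i = c ⟨theta n i, card_theta n i⟩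
  names_unique := by
    rintro p c d hc hd
    funext ⟨A, hA⟩
    obtain ⟨i, rfl⟩ := exists_theta n A hA
    exact Fin.ext ((hc i).symm.trans (hd i))
  exists_name := fun c => ⟨fun i => c ⟨theta n i, card_theta n i⟩, fun _ => rfl⟩

/-- `M` is homogeneous for `c`: all `n`-element subsets of `M` have the same color. -/
def Homogeneous {n k : ℕ} (c : Coloring n k) (M : Set ℕ) : Prop :=
  ∃ j : Fin k, ∀ A : {A : Finset ℕ // A.card = n}, (A.1 : Set ℕ) ⊆ M → c A = j

/-- `c` is stable: `lim_{i → ∞} c (A ∪ {i})` exists for every set `A` of `n - 1` numbers. -/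
def Stable {n k : ℕ} (c : Coloring n k) : Prop :=
  ∀ A : Finset ℕ, A.card + 1 = n →
    ∃ j : Fin k, ∀ᶠ i in atTop, ∃ h : (insert i A).card = n, c ⟨insert i A, h⟩ = j

/-- Ramsey's theorem for cardinality `n` and `k` colors: find an infinite homogeneous set. -/
def RT (n k : ℕ) : Problem (coloringSpace n k) setSpace where
  sol c := {M : Set ℕ | M.Infinite ∧ Homogeneous (n := n) (k := k) c M}

/-- The stable Ramsey theorem: the restriction of `RT n k` to the stable colorings. -/
def SRT (n k : ℕ) : Problem (coloringSpace n k) setSpace where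
  sol c := {M | Stable (n := n) (k := k) c ∧ M ∈ (RT n k).sol c}

end Weihrauch

namespace Weihrauch

open Filter Topology

/-! Only continuity of the two halves of a reduction matters
(`Problem.WeihrauchReducible.exists_continuousOn`). The sources `BWT (k + 1)` and `SRT 2 (k + 1)`
both yield a cluster point of a sequence `x` in `k + 1` colors, so both refutations concern
`ContinuouslyReducible`.

The instance computed from `x` has a limit coloring `d` of `ℕ` in `k` colors, and each color with an
infinite fiber gives one solution. Hence there are at most `k` candidates, each a continuous
function of `x` and a pointwise limit `l x` of continuous functions. By Baire category
(`exists_continuousWithinAt_of_tendsto`), `l` has a point of continuity on every nonempty compact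
set.

At such a point a valid candidate announces the same color on a whole neighbourhood, as long as it
stays valid. Forbidding that color from some place on therefore kills the candidate for good
(`false_of_candidates`). After `k` rounds one color is left but no candidate. -/

/-! ### Continuity of computable reductions. -/

theorem pre_eq_pre {p p' : Baire} {m : ℕ} (h : ∀ n < m, p' n = p n) : pre p' m = pre p m :=
  List.map_congr_left fun n hn => h n (List.mem_range.1 hn)

theorem eventually_eq_below (p : Baire) (m : ℕ) : ∀ᶠ p' in 𝓝 p, ∀ n < m, p' n = p n :=
  (Set.finite_Iio m).eventually_all.2 fun n _ =>
    ((continuous_apply n).continuousAt (x := p)).eventually (p := fun a => a = p n) (by simp)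

/-- A computable partial function on Baire space is continuous on its domain. -/
theorem TypeTwoComputable.exists_continuousOn {F : Baire →. Baire} (hF : TypeTwoComputable F) :
    ∃ f : Baire → Baire, (∀ p, ∀ q ∈ F p, f p = q) ∧ ContinuousOn f {p | (F p).Dom} := by
  classical
  obtain ⟨h, -, -, hp⟩ := hF
  have key : ∀ p, ∀ q ∈ F p, (if hd : (F p).Dom then (F p).get hd else p) = q := by
    intro p q hq
    rw [dif_pos (Part.dom_iff_mem.2 ⟨q, hq⟩)]
    exact Part.get_eq_of_mem hq _
  refine ⟨fun p => if hd : (F p).Dom then (F p).get hd else p, key, ?_⟩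
  intro p hd
  obtain ⟨q, hq⟩ := Part.dom_iff_mem.1 hd
  refine tendsto_pi_nhds.2 fun n => ?_
  -- After `m` letters of input more than `n` letters of output are written, so the prefix of length
  -- `m` fixes the output at `n`.
  obtain ⟨m, hm⟩ := (hp p q hq).2 (n + 1)
  refine tendsto_nhds_of_eventually_eq ?_
  filter_upwards [nhdsWithin_le_nhds (eventually_eq_below p m), self_mem_nhdsWithin] with p' hp' hd'
  obtain ⟨q', hq'⟩ := Part.dom_iff_mem.1 hd'
  rw [key p q hq, key p' q' hq']
  have h1 := (hp p q hq).1 m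
  have h2 := (hp p' q' hq').1 m
  rw [pre_eq_pre hp'] at h2
  have h3 := h2.symm.trans h1
  simp only [pre] at h3
  exact List.map_inj_left.1 h3 n (List.mem_range.2 hm)

/-- The pairing of Baire space used for products of represented spaces. -/
def interleave (p q : Baire) : Baire := fun n => if n % 2 = 0 then p (n / 2) else q (n / 2)

@[simp] theorem interleave_even (p q : Baire) (n : ℕ) : interleave p q (2 * n) = p n := by
  simp [interleave]

@[simp] theorem interleave_odd (p q : Baire) (n : ℕ) : interleave p q (2 * n + 1) = q n := by
  have h1 : (2 * n + 1) % 2 ≠ 0 := by omega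
  have h2 : (2 * n + 1) / 2 = n := by omega
  rw [interleave, if_neg h1, h2]

theorem continuous_interleave : Continuous fun r : Baire × Baire => interleave r.1 r.2 := by
  refine continuous_pi fun n => ?_
  unfold interleave
  split_ifs <;> fun_prop

theorem RepSpace.prod_names_interleave {X Y : RepSpace} {p q : Baire} {x : X.carrier}
    {y : Y.carrier} (hp : X.names p x) (hq : Y.names q y) :
    (X.prod Y).names (interleave p q) (x, y) := by
  simpa [RepSpace.prod] using And.intro hp hq

/-- The names of instances of a problem. -/
def Problem.domNames {X Y : RepSpace} (f : Problem X Y) : Set Baire :=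
  {p | ∃ x ∈ f.dom, X.names p x}

/-- A Weihrauch reduction yields continuous maps on names. -/
theorem Problem.WeihrauchReducible.exists_continuousOn {X Y Z W : RepSpace} {f : Problem X Y}
    {g : Problem W Z} (h : f.WeihrauchReducible g) :
    ∃ (κ : Baire → Baire) (η : Baire × Baire → Baire) (V : Set (Baire × Baire)),
      ContinuousOn κ f.domNames ∧ ContinuousOn η V ∧
      ∀ p, ∀ x ∈ f.dom, X.names p x → ∃ w ∈ g.dom, W.names (κ p) w ∧
        ∀ z ∈ g.sol w, ∀ q, Z.names q z →
          (p, q) ∈ V ∧ ∃ y ∈ f.sol x, Y.names (η (p, q)) y := by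
  obtain ⟨K, H, ⟨FK, hFK, hK⟩, ⟨FH, hFH, hH⟩, hred⟩ := h
  obtain ⟨κ, hκ, hκc⟩ := hFK.exists_continuousOn
  obtain ⟨η, hη, hηc⟩ := hFH.exists_continuousOn
  have hdom : ∀ x ∈ f.dom, x ∈ K.dom ∧ K.sol x ⊆ g.dom := by
    intro x hx
    obtain ⟨⟨_, _, ⟨_, z⟩, ⟨_, hKg, w, hw, _⟩, _⟩, _⟩ := hred x hx
    exact ⟨⟨w, hw⟩, hKg⟩
  refine ⟨κ, fun r => η (interleave r.1 r.2), {r | (FH (interleave r.1 r.2)).Dom},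
    hκc.mono ?_, hηc.comp continuous_interleave.continuousOn fun _ hr => hr, ?_⟩
  · rintro p ⟨x, hx, hpx⟩
    obtain ⟨q, hq, -⟩ := hK p x hpx (hdom x hx).1
    exact Part.dom_iff_mem.2 ⟨q, hq⟩
  · intro p x hx hpx
    obtain ⟨r, hr, w, hw, hrw⟩ := hK p x hpx (hdom x hx).1
    refine ⟨w, (hdom x hx).2 hw, hκ p r hr ▸ hrw, fun z hz q hqz => ?_⟩
    obtain ⟨⟨_, hsub, -⟩, hincl⟩ := hred x hx
    have hxz : (x, z) ∈ ((g.comp K).withInput).sol x := ⟨rfl, (hdom x hx).2, w, hw, hz⟩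
    obtain ⟨s, hs, y, hy, hsy⟩ :=
      hH _ _ (RepSpace.prod_names_interleave hpx hqz) (hsub hxz)
    exact ⟨Part.dom_iff_mem.2 ⟨s, hs⟩, y, hincl ⟨hsub, (x, z), hxz, hy⟩, by
      simpa only [hη _ s hs] using hsy⟩

/-! ### Baire category. -/

/-- A pointwise limit of continuous functions into a sequence space has a point of continuity on
every nonempty compact set. -/
theorem exists_continuousWithinAt_of_tendsto {X D : Type*} [TopologicalSpace X] [T2Space X]
    [TopologicalSpace D] [DiscreteTopology D] {L : ℕ → X → ℕ → D} {l : X → ℕ → D}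
    (hL : ∀ i, Continuous (L i)) (hl : ∀ x n, ∀ᶠ i in atTop, L i x n = l x n)
    {C : Set X} (hC : IsCompact C) (hne : C.Nonempty) :
    ∃ x ∈ C, ContinuousWithinAt l C x := by
  have : CompactSpace C := isCompact_iff_compactSpace.1 hC
  have : Nonempty C := hne.to_subtype
  have hcont : ∀ i n, Continuous fun x : C => L i x n := fun i n => by fun_prop
  -- `A n s` collects the points whose coordinate `n` is constant from stage `s` on. For fixed `n`
  -- these closed sets cover `C`, so the union of their interiors is dense and open; on such an
  -- interior `l` agrees with `L s` at `n`.
  let A : ℕ → ℕ → Set C := fun n s => {x | ∀ i, s ≤ i → L i x n = L s x n}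
  have hA : ∀ n s, IsClosed (A n s) := by
    intro n s
    simp only [A, Set.ofPred_forall]
    exact isClosed_iInter fun i => isClosed_iInter fun _ => isClosed_eq (hcont i n) (hcont s n)
  have hAu : ∀ n, ⋃ s, A n s = Set.univ := by
    intro n
    refine Set.eq_univ_of_forall fun x => ?_
    obtain ⟨s, hs⟩ := eventually_atTop.1 (hl x n)
    exact Set.mem_iUnion.2 ⟨s, fun i hi => (hs i hi).trans (hs s le_rfl).symm⟩
  have hdense : Dense (⋂ n, ⋃ s, interior (A n s)) :=
    dense_iInter_of_isOpen (fun n => isOpen_iUnion fun s => isOpen_interior)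
      fun n => dense_iUnion_interior_of_closed (hA n) (hAu n)
  obtain ⟨x, hx⟩ := hdense.nonempty
  refine ⟨x, x.2, ?_⟩
  rw [continuousWithinAt_iff_continuousAt_domRestrict l x.2]
  refine tendsto_pi_nhds.2 fun n => ?_
  obtain ⟨s, hs⟩ := Set.mem_iUnion.1 (Set.mem_iInter.1 hx n)
  have hval : ∀ y ∈ A n s, L s y n = l y n := by
    intro y hy
    obtain ⟨i, hi, hi'⟩ := ((eventually_ge_atTop s).and (hl y n)).exists
    rw [← hy i hi, hi']
  have h1 : ∀ᶠ y in 𝓝 x, y ∈ A n s := mem_interior_iff_mem_nhds.1 hs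
  have h2 : ContinuousAt (fun y : C => L s y n) x := (hcont s n).continuousAt
  have h3 := h2.congr (h1.mono hval)
  exact h3

/-! ### Elimination of colors and candidates. -/

/-- The sequences that agree with `w` below `N` and take values in `S` from then on. -/
def tailSet {α : Type*} (w : ℕ → α) (N : ℕ) (S : Set α) : Set (ℕ → α) :=
  {x | ∀ n, (n < N → x n = w n) ∧ (N ≤ n → x n ∈ S)}

theorem isClosed_tailSet {α : Type*} [TopologicalSpace α] [DiscreteTopology α] (w : ℕ → α)
    (N : ℕ) (S : Set α) : IsClosed (tailSet w N S) := by
  simp only [tailSet, Set.ofPred_forall, Set.ofPred_and]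
  refine isClosed_iInter fun n => IsClosed.inter (isClosed_iInter fun _ => ?_)
    (isClosed_iInter fun _ => ?_)
  · exact isClosed_eq (continuous_apply n) continuous_const
  · exact (isClosed_discrete S).preimage (continuous_apply n)

theorem tailSet_nonempty {α : Type*} (w : ℕ → α) (N : ℕ) {S : Set α} (hS : S.Nonempty) :
    (tailSet w N S).Nonempty := by
  obtain ⟨a, ha⟩ := hS
  exact ⟨fun n => if n < N then w n else a, fun n =>
    ⟨fun h => if_pos h, fun h => by simpa [not_lt.2 h] using ha⟩⟩

/-- A cluster point of a sequence of `k + 1` colors cannot be found from one of `k` candidates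
by a selection that has a point of continuity on every nonempty closed set. -/
theorem false_of_candidates {k : ℕ} (T : (ℕ → Fin (k + 1)) → Set (Fin k))
    (Φ : (ℕ → Fin (k + 1)) → Fin k → Fin (k + 1)) (hT : ∀ x, (T x).Nonempty)
    (hΦ : ∀ x, ∀ i ∈ T x, ∃ᶠ n in atTop, x n = Φ x i)
    (hc : ∀ C : Set (ℕ → Fin (k + 1)), IsClosed C → C.Nonempty →
      ∃ x ∈ C, ∀ i ∈ T x, ∀ᶠ y in 𝓝[C] x, i ∈ T y → Φ y i = Φ x i) : False := by
  -- Invariant after `t` rounds: `t` colors are forbidden from `N` on, and the `t` candidates in `D`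
  -- are invalid for every remaining sequence.
  have key : ∀ t ≤ k, ∃ (w : ℕ → Fin (k + 1)) (N : ℕ) (S : Finset (Fin (k + 1)))
      (D : Finset (Fin k)), S.card = k + 1 - t ∧ D.card = t ∧
        ∀ y ∈ tailSet w N (S : Set (Fin (k + 1))), ∀ i ∈ T y, i ∉ D := by
    intro t
    induction t with
    | zero => exact fun _ => ⟨fun _ => 0, 0, Finset.univ, ∅, by simp, rfl, by simp⟩
    | succ t ih =>
      intro ht
      obtain ⟨w, N, S, D, hS, hD, hdead⟩ := ih (by omega)
      have hSne : S.Nonempty := Finset.card_pos.1 (by omega)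
      obtain ⟨x, hxC, hx⟩ := hc _ (isClosed_tailSet w N (S : Set _))
        (tailSet_nonempty w N (Finset.coe_nonempty.2 hSne))
      obtain ⟨i, hi⟩ := hT x
      have hj : Φ x i ∈ S := by
        obtain ⟨n, hn, hn'⟩ := ((hΦ x i hi).and_eventually (eventually_ge_atTop N)).exists
        exact hn ▸ (hxC n).2 hn'
      have hev := hx i hi
      obtain ⟨U, hU, hUC⟩ := mem_nhdsWithin_iff_exists_mem_nhds_inter.1 hev
      have hm : ∃ m, ∀ y : ℕ → Fin (k + 1), (∀ n < m, y n = x n) → y ∈ U := by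
        rw [nhds_pi, Filter.mem_pi] at hU
        obtain ⟨I, hI, s, hs, hsU⟩ := hU
        obtain ⟨m, hm⟩ := hI.bddAbove
        exact ⟨m + 1, fun y hy => hsU fun n hn => by
          rw [hy n (Nat.lt_succ_of_le (hm hn))]; exact mem_of_mem_nhds (hs n)⟩
      obtain ⟨m, hm⟩ := hm
      have hiD : i ∉ D := hdead x hxC i hi
      -- Keeping `x` up to `m` stays inside the neighbourhood where `i`, if valid, still announces
      -- `Φ x i`; that color no longer occurs from `max m N` on, so `i` is never valid.
      refine ⟨x, max m N, S.erase (Φ x i), insert i D, ?_, ?_, ?_⟩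
      · rw [Finset.card_erase_of_mem hj]; omega
      · rw [Finset.card_insert_of_notMem hiD, hD]
      · intro y hy i' hi' hmem
        have hyC : y ∈ tailSet w N (S : Set (Fin (k + 1))) := by
          intro n
          refine ⟨fun h => ?_, fun h => ?_⟩
          · rw [(hy n).1 (lt_max_of_lt_right h), (hxC n).1 h]
          · rcases lt_or_ge n (max m N) with h' | h'
            · rw [(hy n).1 h']; exact (hxC n).2 h
            · exact Finset.mem_of_mem_erase ((hy n).2 h')
        rcases Finset.mem_insert.1 hmem with rfl | hmem
        · have h1 : Φ y i' = Φ x i' :=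
            hUC ⟨hm y fun n hn => (hy n).1 (lt_max_of_lt_left hn), hyC⟩ hi'
          obtain ⟨n, hn, hn'⟩ :=
            ((hΦ y i' hi').and_eventually (eventually_ge_atTop (max m N))).exists
          exact Finset.ne_of_mem_erase ((hy n).2 hn') (hn.trans h1)
        · exact hdead y hyC i' hi' hmem
  obtain ⟨w, N, S, D, hS, hD, hdead⟩ := key k le_rfl
  obtain ⟨y, hy⟩ := tailSet_nonempty w N (S := (S : Set (Fin (k + 1))))
    (Finset.coe_nonempty.2 (Finset.card_pos.1 (by omega)))
  obtain ⟨i, hi⟩ := hT y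
  have hDu : D = Finset.univ := Finset.eq_univ_of_card D (by simpa using hD)
  exact hdead y hy i hi (hDu ▸ Finset.mem_univ i)

/-! ### Continuous reductions for cluster points. -/

/-- A continuous reduction of `BWT k` to `g`: `κ` maps sequences to names of instances of `g`, and
`η` maps a sequence and a name of a solution to a cluster point. -/
def ContinuouslyReducible {W Z : RepSpace} (k : ℕ) (g : Problem W Z) : Prop :=
  ∃ (κ : (ℕ → Fin k) → Baire) (η : (ℕ → Fin k) × Baire → Fin k) (V : Set ((ℕ → Fin k) × Baire)),
    Continuous κ ∧ ContinuousOn η V ∧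
    ∀ x, ∃ w ∈ g.dom, W.names (κ x) w ∧
      ∀ z ∈ g.sol w, ∀ q, Z.names q z → (x, q) ∈ V ∧ ∃ᶠ n in atTop, x n = η (x, q)

/-- Cluster points of sequences of `k + 1` colors cannot be found continuously from one of `k`
candidates, where the candidates depend continuously on the sequence `x` and on a pointwise limit
`l x` of continuous functions. -/
theorem false_of_limit_candidates {k : ℕ} {D : Type*} [TopologicalSpace D] [DiscreteTopology D]
    {η : (ℕ → Fin (k + 1)) × Baire → Fin (k + 1)} {V : Set ((ℕ → Fin (k + 1)) × Baire)}
    (hη : ContinuousOn η V) {L : ℕ → (ℕ → Fin (k + 1)) → ℕ → D} {l : (ℕ → Fin (k + 1)) → ℕ → D}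
    (hL : ∀ i, Continuous (L i)) (hl : ∀ x n, ∀ᶠ i in atTop, L i x n = l x n)
    (T : (ℕ → Fin (k + 1)) → Set (Fin k)) (hT : ∀ x, (T x).Nonempty)
    (ψ : Fin k → (ℕ → Fin (k + 1)) × (ℕ → D) → Baire) (hψ : ∀ i, Continuous (ψ i))
    (h : ∀ x, ∀ i ∈ T x, (x, ψ i (x, l x)) ∈ V ∧
      ∃ᶠ n in atTop, x n = η (x, ψ i (x, l x))) : False := by
  refine false_of_candidates T (fun x i => η (x, ψ i (x, l x))) hT (fun x i hi => (h x i hi).2) ?_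
  intro C hC hne
  obtain ⟨x, hx, hxl⟩ := exists_continuousWithinAt_of_tendsto hL hl hC.isCompact hne
  refine ⟨x, hx, fun i hi => ?_⟩
  -- The restriction to points where `i` is valid is needed because `η` is continuous only on `V`.
  have h1 : ContinuousWithinAt (fun y => (y, ψ i (y, l y))) (C ∩ {y | i ∈ T y}) x :=
    (continuousWithinAt_id.prodMk ((hψ i).continuousAt.comp_continuousWithinAt
      (continuousWithinAt_id.prodMk hxl))).mono Set.inter_subset_left
  have h2 : ContinuousWithinAt (fun y => η (y, ψ i (y, l y))) (C ∩ {y | i ∈ T y}) x :=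
    (hη _ (h x i hi).1).comp (f := fun y => (y, ψ i (y, l y))) h1 fun y hy => (h y i hy.2).1
  have h3 := h2.eventually (p := fun j => j = η (x, ψ i (x, l x))) (by simp)
  rw [nhdsWithin_inter', eventually_inf_principal] at h3
  exact h3

theorem exists_infinite_fiber {k : ℕ} (d : ℕ → Fin k) : {i | {n | d n = i}.Infinite}.Nonempty := by
  obtain ⟨i, hi⟩ := Finite.exists_infinite_fiber d
  exact ⟨i, Set.infinite_coe_iff.1 hi⟩

theorem continuous_indicator_one {X : Type*} [TopologicalSpace X] {M : X → Set ℕ}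
    (h : ∀ n, IsClopen {x | n ∈ M x}) : Continuous fun x => ((M x).indicator 1 : Baire) := by
  refine continuous_pi fun n => ?_
  have : (fun x => ((M x).indicator 1 : Baire) n) = {x | n ∈ M x}.indicator fun _ => 1 := by
    classical
    funext x
    simp [Set.indicator_apply]
  rw [this]
  exact (h n).continuous_indicator continuous_const

/-- Here `ν` and `π` reduce the search for cluster points to `f`; composing them with the reduction
of `f` to `g` keeps continuity. -/
theorem Problem.WeihrauchReducible.continuouslyReducible {X Y Z W : RepSpace} {f : Problem X Y}
    {g : Problem W Z} (h : f.WeihrauchReducible g) {k : ℕ} {ν : (ℕ → Fin k) → Baire}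
    {π : (ℕ → Fin k) × Baire → Fin k} {Q : Set ((ℕ → Fin k) × Baire)} (hν : Continuous ν)
    (hπ : ContinuousOn π Q)
    (hf : ∀ x, ∃ a ∈ f.dom, X.names (ν x) a ∧
      ∀ y ∈ f.sol a, ∀ q, Y.names q y → (x, q) ∈ Q ∧ ∃ᶠ n in atTop, x n = π (x, q)) :
    ContinuouslyReducible k g := by
  obtain ⟨κ, η, V, hκ, hη, hr⟩ := h.exists_continuousOn
  have hνm : Continuous fun r : (ℕ → Fin k) × Baire => (ν r.1, r.2) := by fun_prop
  refine ⟨fun x => κ (ν x), fun r => π (r.1, η (ν r.1, r.2)),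
    {r | (ν r.1, r.2) ∈ V ∧ (r.1, η (ν r.1, r.2)) ∈ Q}, ?_, ?_, ?_⟩
  · refine hκ.comp_continuous hν fun x => ?_
    obtain ⟨a, ha, hxa, -⟩ := hf x
    exact ⟨a, ha, hxa⟩
  · have h1 : ContinuousOn (fun r : (ℕ → Fin k) × Baire => η (ν r.1, r.2))
        {r | (ν r.1, r.2) ∈ V ∧ (r.1, η (ν r.1, r.2)) ∈ Q} :=
      hη.comp hνm.continuousOn fun r hr => hr.1
    exact hπ.comp (continuous_fst.continuousOn.prodMk h1) fun r hr => hr.2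
  · intro x
    obtain ⟨a, ha, hxa, hsol⟩ := hf x
    obtain ⟨w, hw, hκw, hz⟩ := hr (ν x) a ha hxa
    refine ⟨w, hw, hκw, fun z hzs q hq => ?_⟩
    obtain ⟨hV, y, hy, hny⟩ := hz z hzs q hq
    obtain ⟨hQ, hcl⟩ := hsol y hy _ hny
    exact ⟨⟨hV, hQ⟩, hcl⟩

theorem frequently_eq_of_mapClusterPt {k : ℕ} {x : ℕ → Fin k} {j : Fin k}
    (h : MapClusterPt j atTop x) : ∃ᶠ n in atTop, x n = j :=
  mapClusterPt_iff_frequently.1 h {j} (by simp)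

theorem continuouslyReducible_of_BWT {Z W : RepSpace} {g : Problem W Z} {k : ℕ}
    (h : (BWT (k + 1)).WeihrauchReducible g) : ContinuouslyReducible (k + 1) g := by
  refine h.continuouslyReducible (ν := fun x n => x n) (π := fun r => Fin.ofNat (k + 1) (r.2 0))
    (Q := Set.univ) ?_ ?_ ?_
  · exact continuous_pi fun n => continuous_of_discreteTopology.comp (continuous_apply n)
  · have h0 : Continuous fun r : (ℕ → Fin (k + 1)) × Baire => r.2 0 := by fun_prop
    exact ((continuous_of_discreteTopology (f := fun n : ℕ => Fin.ofNat (k + 1) n)).comp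
      h0).continuousOn
  · intro x
    obtain ⟨j, hj⟩ := exists_clusterPt_of_compactSpace (map x atTop)
    refine ⟨x, ⟨j, hj⟩, fun _ => rfl, fun (y : Fin (k + 1)) hy q hq => ⟨Set.mem_univ _, ?_⟩⟩
    have hqy : Fin.ofNat (k + 1) (q 0) = y := by
      rw [show q 0 = (y : ℕ) from hq]; exact Fin.ofNat_val_eq_self y
    simpa only [hqy] using frequently_eq_of_mapClusterPt hy

theorem theta_two (i : ℕ) : theta 2 i = {i.unpair.1, i.unpair.1 + i.unpair.2 + 1} := by
  ext a
  simp [theta]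
  omega

/-- The coloring of pairs by the color of the minimum. -/
def minColoring {k : ℕ} (x : ℕ → Fin k) : Coloring 2 k :=
  fun A => x (A.1.min' (Finset.card_pos.1 (by rw [A.2]; norm_num)))

theorem minColoring_pair {k : ℕ} (x : ℕ → Fin k) {a b : ℕ} (hab : a < b) {A : Finset ℕ}
    (hA : A = {a, b}) (h : A.card = 2) : minColoring x ⟨A, h⟩ = x a := by
  subst hA
  refine congrArg x ?_
  refine le_antisymm (Finset.min'_le _ _ (by simp)) (Finset.le_min' _ _ _ ?_)
  simp only [Finset.mem_insert, Finset.mem_singleton]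
  omega

theorem stable_minColoring {k : ℕ} (x : ℕ → Fin k) : Stable (n := 2) (k := k) (minColoring x) := by
  intro A hA
  obtain ⟨a, rfl⟩ := Finset.card_eq_one.1 (show A.card = 1 by omega)
  refine ⟨x a, (eventually_gt_atTop a).mono fun i hi => ?_⟩
  exact ⟨Finset.card_pair (by omega), minColoring_pair x hi (Finset.pair_comm _ _) _⟩

/-- The least element of an infinite set that is homogeneous for `minColoring x` is a position of
a cluster point of `x`. -/
theorem frequently_eq_of_homogeneous_minColoring {k : ℕ} {x : ℕ → Fin k} {M : Set ℕ}
    (hM : M.Infinite) (h : Homogeneous (n := 2) (k := k) (minColoring x) M) {a : ℕ} (ha : a ∈ M) :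
    ∃ᶠ n in atTop, x n = x a := by
  obtain ⟨j, hj⟩ := h
  have hx : ∀ n ∈ M, x n = j := by
    intro n hn
    obtain ⟨b, hb, hnb⟩ := hM.exists_gt n
    rw [← hj ⟨{n, b}, Finset.card_pair hnb.ne⟩ (by simp [Set.insert_subset_iff, hn, hb]),
      minColoring_pair x hnb rfl]
  rw [hx a ha]
  exact (Nat.frequently_atTop_iff_infinite.2 hM).mono hx

theorem continuouslyReducible_of_SRT {Z W : RepSpace} {g : Problem W Z} {k : ℕ}
    (h : (SRT 2 k).WeihrauchReducible g) : ContinuouslyReducible k g := by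
  -- The instance is a name of `minColoring x`. The answer is the color of `x` at the least element
  -- of the solution, which a finite prefix of a nonempty set determines.
  refine h.continuouslyReducible (ν := fun x n => x n.unpair.1)
    (π := fun r => r.1 (sInf {n | r.2 n ≠ 0})) (Q := {r | ∃ n, r.2 n ≠ 0}) ?_ ?_ ?_
  · exact continuous_pi fun n => continuous_of_discreteTopology.comp (continuous_apply _)
  · rintro ⟨x, q⟩ hq
    set m := sInf {n | q n ≠ 0} with hm
    have hmem : q m ≠ 0 := Nat.sInf_mem (s := {n | q n ≠ 0}) hq
    refine tendsto_nhds_of_eventually_eq (mem_nhdsWithin_of_mem_nhds ?_)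
    have h1 : ∀ᶠ r : (ℕ → Fin k) × Baire in 𝓝 (x, q), r.1 m = x m :=
      (by fun_prop : Continuous fun r : (ℕ → Fin k) × Baire => r.1 m).continuousAt.eventually
        (p := fun a => a = x m) (by simp)
    have h2 : ∀ᶠ r : (ℕ → Fin k) × Baire in 𝓝 (x, q), ∀ n < m + 1, r.2 n = q n :=
      (continuous_snd.tendsto (x, q)).eventually (eventually_eq_below q (m + 1))
    filter_upwards [h1, h2] with r hr1 hr2
    have : sInf {n | r.2 n ≠ 0} = m := by
      refine le_antisymm (Nat.sInf_le ?_) (le_csInf ⟨m, ?_⟩ fun n hn => ?_)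
      · exact (hr2 m (by omega)).trans_ne hmem
      · exact (hr2 m (by omega)).trans_ne hmem
      · by_contra hlt
        have hnm : n < m := not_le.1 hlt
        have hqn : q n ≠ 0 := hr2 n (by omega) ▸ hn
        exact hlt (Nat.sInf_le hqn)
    simp only [this, hr1]
    rfl
  · intro x
    obtain ⟨i, hi⟩ := exists_infinite_fiber x
    refine ⟨minColoring x, ⟨{n | x n = i}, stable_minColoring x, hi, i, ?_⟩, ?_, ?_⟩
    · rintro ⟨A, hA⟩ hAM
      exact hAM (Finset.min'_mem A _)
    · intro n
      rw [minColoring_pair x (by omega) (theta_two n)]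
    · rintro (M : Set ℕ) ⟨-, hM, hh⟩ q rfl
      classical
      have hset : {n | (M.indicator 1 : Baire) n ≠ 0} = M := by
        ext n; simp [Set.indicator_apply]
      obtain ⟨a, ha⟩ := hM.nonempty
      refine ⟨⟨a, hset.symm.subset ha⟩, ?_⟩
      simp only [hset]
      exact frequently_eq_of_homogeneous_minColoring hM hh (Nat.sInf_mem ⟨a, ha⟩)

/-! ### The target `(RT 1 k).jump.prod lim`. -/

theorem eventually_eq_of_tendsto {u : ℕ → Baire} {q : Baire} (h : Tendsto u atTop (𝓝 q)) (n : ℕ) :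
    ∀ᶠ i in atTop, u i n = q n :=
  (tendsto_pi_nhds.1 h n).eventually (p := fun a => a = q n) (by simp)

theorem not_continuouslyReducible_RT_jump_prod_lim (k : ℕ) :
    ¬ ContinuouslyReducible (k + 1) ((RT 1 k).jump.prod lim) := by
  rintro ⟨κ, η, V, hκ, hη, h⟩
  have hdata : ∀ x, ∃ (d : ℕ → Fin k) (r : Baire),
      (∀ n, ∀ᶠ i in atTop, κ x (2 * Nat.pair i n) = d n) ∧
      (∀ n, ∀ᶠ i in atTop, κ x (2 * Nat.pair i n + 1) = r n) ∧
      ∀ i, {n | d n = i}.Infinite →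
        (x, interleave ({n | d n = i}.indicator 1) r) ∈ V ∧
          ∃ᶠ n in atTop, x n = η (x, interleave ({n | d n = i}.indicator 1) r) := by
    intro x
    obtain ⟨⟨c, w⟩, ⟨⟨M, r⟩, hM, hr⟩, ⟨⟨e, he, hec⟩, hw⟩, hsol⟩ := h x
    replace hw : (fun n => κ x (2 * n + 1)) = w := hw
    subst hw
    refine ⟨fun n => c ⟨{n}, rfl⟩, r, fun n => ?_, fun n => eventually_eq_of_tendsto hr n, ?_⟩
    · exact (eventually_eq_of_tendsto he n).mono fun i hi => hi.trans (hec n)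
    · intro i hi
      refine hsol ({n | c ⟨{n}, rfl⟩ = i}, r) ⟨⟨hi, i, ?_⟩, hr⟩ _
        (RepSpace.prod_names_interleave rfl rfl)
      rintro ⟨A, hA⟩ hAM
      obtain ⟨a, rfl⟩ := Finset.card_eq_one.1 hA
      exact hAM (Finset.mem_coe.2 (Finset.mem_singleton_self a))
  choose d r hd hr hV using hdata
  -- The jumped coloring and the `lim` instance are packed into one limit of pairs; candidate `i` is
  -- the fiber of `d` over `i` together with `r`.
  refine false_of_limit_candidates hη (D := ℕ × ℕ)
    (L := fun i x n => (κ x (2 * Nat.pair i n), κ x (2 * Nat.pair i n + 1)))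
    (l := fun x n => ((d x n : ℕ), r x n)) (fun i => by fun_prop) (fun x n => ?_)
    (fun x => {i | {n | d x n = i}.Infinite}) (fun x => exists_infinite_fiber (d x))
    (fun i z => interleave ({n | (z.2 n).1 = i}.indicator 1) fun n => (z.2 n).2) (fun i => ?_) ?_
  · filter_upwards [hd x n, hr x n] with i h1 h2
    rw [h1, h2]
  · refine continuous_interleave.comp (Continuous.prodMk
      (f := fun z : (ℕ → Fin (k + 1)) × (ℕ → ℕ × ℕ) => {n | (z.2 n).1 = i}.indicator 1)
      (g := fun z n => (z.2 n).2) (continuous_indicator_one fun n => ?_) (by fun_prop))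
    exact (isClopen_discrete {(i : ℕ)}).preimage
      (by fun_prop : Continuous fun z : (ℕ → Fin (k + 1)) × (ℕ → ℕ × ℕ) => (z.2 n).1)
  · intro x i hi
    simpa only [Fin.val_inj] using hV x i hi

/-! ### Greedy homogeneous sets and the target `SRT 2 k`. -/

/-- The greedy subset of `P` whose pairs satisfy `Q`. -/
def greedy (P : ℕ → Prop) (Q : ℕ → ℕ → Prop) (n : ℕ) : Prop :=
  P n ∧ ∀ m, m < n → greedy P Q m → Q m n
termination_by n

theorem greedy_iff (P : ℕ → Prop) (Q : ℕ → ℕ → Prop) (n : ℕ) :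
    greedy P Q n ↔ P n ∧ ∀ m, m < n → greedy P Q m → Q m n := by
  rw [greedy]

/-- If only finitely many numbers were chosen, almost every `n` would be compatible with all of
them, so a large `n` in `P` would be chosen too. -/
theorem infinite_greedy {P : ℕ → Prop} {Q : ℕ → ℕ → Prop} (hP : {n | P n}.Infinite)
    (hQ : ∀ m, P m → ∀ᶠ n in atTop, Q m n) : {n | greedy P Q n}.Infinite := by
  intro hfin
  have h1 : ∀ᶠ n in atTop, ∀ m ∈ {n | greedy P Q n}, Q m n :=
    hfin.eventually_all.2 fun m hm => hQ m ((greedy_iff P Q m).1 hm).1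
  have h2 : ∀ᶠ n in atTop, n ∉ {n | greedy P Q n} :=
    Nat.cofinite_eq_atTop ▸ hfin.eventually_cofinite_notMem
  obtain ⟨n, hn, h1, h2⟩ :=
    ((Nat.frequently_atTop_iff_infinite.2 hP).and_eventually (h1.and h2)).exists
  exact h2 ((greedy_iff P Q n).2 ⟨hn, fun m _ hm => h1 m hm⟩)

theorem isClopen_greedy {X : Type*} [TopologicalSpace X] {P : X → ℕ → Prop} {Q : X → ℕ → ℕ → Prop}
    (hP : ∀ n, IsClopen {x | P x n}) (hQ : ∀ m n, IsClopen {x | Q x m n}) (n : ℕ) :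
    IsClopen {x | greedy (P x) (Q x) n} := by
  induction n using Nat.strong_induction_on with
  | _ n ih =>
    have : {x | greedy (P x) (Q x) n} = {x | P x n} ∩
        ⋂ m ∈ Set.Iio n, ({x | greedy (P x) (Q x) m}ᶜ ∪ {x | Q x m n}) := by
      ext x
      simp only [Set.mem_ofPred_eq, Set.mem_inter_iff, Set.mem_iInter, Set.mem_union,
        Set.mem_compl_iff, Set.mem_Iio, ← imp_iff_not_or]
      exact greedy_iff _ _ _
    rw [this]
    exact (hP n).inter ((Set.finite_Iio n).isClopen_biInter fun m hm =>
      (ih m hm).compl.union (hQ m n))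

/-- With `d n` the limit color of pairs containing `n`, an infinite fiber of `d` over `i` contains
an infinite homogeneous set, chosen greedily. Each membership needs only finitely many values of `d`
and of the coloring. -/
theorem not_continuouslyReducible_SRT_two (k : ℕ) :
    ¬ ContinuouslyReducible (k + 1) (SRT 2 k) := by
  rintro ⟨κ, η, V, hκ, hη, h⟩
  have hdata : ∀ x, ∃ d : ℕ → Fin k, (∀ n, ∀ᶠ i in atTop, κ x (Nat.pair n i) = d n) ∧
      ∀ M : Set ℕ, M.Infinite →
        -- The pair `{m, n}` with `m < n` has number `Nat.pair m (n - m - 1)` under `theta 2`.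
        (∃ j : Fin k, ∀ m ∈ M, ∀ n ∈ M, m < n → κ x (Nat.pair m (n - m - 1)) = j) →
        (x, M.indicator 1) ∈ V ∧ ∃ᶠ n in atTop, x n = η (x, M.indicator 1) := by
    intro x
    obtain ⟨c, ⟨M, hc, -⟩, hn, hsol⟩ := h x
    have hpair : ∀ (m i : ℕ) (A) (hA : A.card = 2), A = {m, m + i + 1} →
        κ x (Nat.pair m i) = c ⟨A, hA⟩ := by
      rintro m i A hA rfl
      rw [hn (Nat.pair m i)]
      congr 3
      rw [theta_two, Nat.unpair_pair]
    have hlim : ∀ n, ∃ j : Fin k, ∀ᶠ i in atTop, κ x (Nat.pair n i) = j := by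
      intro n
      obtain ⟨j, hj⟩ := hc {n} rfl
      refine ⟨j, ?_⟩
      filter_upwards [(tendsto_add_atTop_nat (n + 1)).eventually hj] with i ⟨hi, hij⟩
      rw [← hij]
      refine hpair n i _ _ ?_
      rw [Finset.pair_comm]
      congr 2
      omega
    choose d hd using hlim
    refine ⟨d, hd, fun M hM ⟨j, hj⟩ => hsol M ⟨hc, hM, j, ?_⟩ _ rfl⟩
    rintro ⟨A, hA⟩ hAM
    obtain ⟨i, rfl⟩ := exists_theta 2 A hA
    have hmem : (i.unpair.1 ∈ M) ∧ i.unpair.1 + i.unpair.2 + 1 ∈ M := by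
      simpa [theta_two, Set.insert_subset_iff] using hAM
    have h1 := hj _ hmem.1 _ hmem.2 (by omega)
    have h2 : i.unpair.1 + i.unpair.2 + 1 - i.unpair.1 - 1 = i.unpair.2 := by omega
    rw [h2, Nat.pair_unpair, hn i] at h1
    exact Fin.ext h1
  choose d hd hV using hdata
  refine false_of_limit_candidates hη (D := ℕ) (L := fun i x n => κ x (Nat.pair n i))
    (l := fun x n => d x n) (fun i => by fun_prop) (fun x n => hd x n)
    (fun x => {i | {n | d x n = i}.Infinite}) (fun x => exists_infinite_fiber (d x))
    (fun i z => {n | greedy (fun n => z.2 n = i)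
      (fun m n => κ z.1 (Nat.pair m (n - m - 1)) = i) n}.indicator 1) (fun i => ?_) ?_
  · refine continuous_indicator_one (isClopen_greedy (fun n => ?_) fun m n => ?_)
    · exact (isClopen_discrete {(i : ℕ)}).preimage
        (by fun_prop : Continuous fun z : (ℕ → Fin (k + 1)) × (ℕ → ℕ) => z.2 n)
    · exact (isClopen_discrete {(i : ℕ)}).preimage (by fun_prop :
        Continuous fun z : (ℕ → Fin (k + 1)) × (ℕ → ℕ) => κ z.1 (Nat.pair m (n - m - 1)))
  · intro x i hi
    refine hV x _ (infinite_greedy ?_ fun m hm => ?_) ⟨i, fun m hm n hn hmn => ?_⟩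
    · simpa only [Fin.val_inj] using (show {n | d x n = i}.Infinite from hi)
    · have h1 := ((tendsto_sub_atTop_nat 1).comp (tendsto_sub_atTop_nat m)).eventually (hd x m)
      filter_upwards [h1] with n hn
      exact hn.trans hm
    · exact ((greedy_iff _ _ n).1 hn).2 m hmn hm

end Weihrauch

theorem theorem6p5 (k : ℕ) (hk : 1 ≤ k) :
    ¬ (Weihrauch.BWT (k + 1)).WeihrauchReducible
        ((Weihrauch.RT 1 k).jump.prod Weihrauch.lim) ∧
    ¬ (Weihrauch.BWT (k + 1)).WeihrauchReducible (Weihrauch.SRT 2 k) ∧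
    ¬ (Weihrauch.SRT 2 (k + 1)).WeihrauchReducible (Weihrauch.SRT 2 k) :=
  ⟨fun h => Weihrauch.not_continuouslyReducible_RT_jump_prod_lim k
      (Weihrauch.continuouslyReducible_of_BWT h),
    fun h => Weihrauch.not_continuouslyReducible_SRT_two k
      (Weihrauch.continuouslyReducible_of_BWT h),
    fun h => Weihrauch.not_continuouslyReducible_SRT_two k
      (Weihrauch.continuouslyReducible_of_SRT h)⟩
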